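/- Let $\alpha\in[0,1)$ and $\theta>-\alpha$. Let $H_1,H_2,\dots$ be independent random variables, $H_i$ having the $\mathrm{Beta}(1-\alpha,\theta+i\alpha)$ distribution, and put $Y_k=1-\prod_{i=1}^k(1-H_i)$ for $k\ge 0$; then almost surely the numbers $p_k=Y_k-Y_{k-1}$, $k\ge1$, form a probability distribution on $\{1,2,\dots\}$. The $\mathrm{GEM}(\alpha,\theta)$ exchangeable distribution is the unconditional law of a sequence of positive integer random variables which, given $(Y_k)_{k\ge 1}$, is i.i.d. with $\mathbb P[X_1\le k\mid (Y_i)_{i\ge1}]=Y_k$ for $k\ge1$. Theorem. Let $X_1,X_2,\dots$ have the $\mathrm{GEM}(\alpha,\theta)$ exchangeable distribution, let $M_n=\max(X_1,\dots,X_n)$, and let $L_n=\sum_{j=1}^n \mathbf 1_{\{X_j=M_n\}}$ be the number of sample values equal to the maximum. Then $$\mathbb P\Bigl[\limsup_{n\to\infty} L_n=1\Bigr]=1\quad\text{if }\alpha>0,\qquad \mathbb P\Bigl[\limsup_{n\to\infty} L_n=\infty\Bigr]=1\quad\text{if }\alpha=0.$$ -/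

import Mathlib

open MeasureTheory ProbabilityTheory Filter

namespace GEM

/-- `Y_k = 1 - ∏_{i=1}^k (1 - H_i)`, where `H_{i+1}` is stored as `h i`; in particular `Y_0 = 0`. -/
noncomputable def cutPoint (h : ℕ → ℝ) (k : ℕ) : ℝ :=
  1 - ∏ i ∈ Finset.range k, (1 - h i)

/-- The joint law of `(H_1, H_2, …)`: independent, `H_i` with the
`Beta(1 - α, θ + i α)` distribution. Coordinate `i` of the sequence is `H_{i+1}`. -/
noncomputable def hazardLaw (α θ : ℝ) : Measure (ℕ → ℝ) :=
  Measure.infinitePi fun i : ℕ => betaMeasure (1 - α) (θ + ((i : ℝ) + 1) * α)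

/-- The measure on `{1, 2, …} ⊆ ℕ` with mass `p_k = y_k - y_{k-1}` at each `k ≥ 1`. -/
noncomputable def massMeasure (y : ℕ → ℝ) : Measure ℕ :=
  Measure.sum fun k : ℕ => ENNReal.ofReal (y (k + 1) - y k) • Measure.dirac (k + 1)

open Classical in
/-- The probability measure on `{1, 2, …}` with distribution function `k ↦ y_k`.
If the increments of `y` are not the weights of a probability measure (which has probability zero
when `y` is the random sequence of cut points), the value is the point mass at `1` by convention. -/
noncomputable def valueLaw (y : ℕ → ℝ) : Measure ℕ :=
  if massMeasure y Set.univ = 1 then massMeasure y else Measure.dirac 1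

instance isProbabilityMeasure_valueLaw (y : ℕ → ℝ) : IsProbabilityMeasure (valueLaw y) := by
  unfold valueLaw
  split_ifs with h
  · exact ⟨h⟩
  · infer_instance

theorem measurable_massMeasure : Measurable massMeasure := by
  refine Measure.measurable_of_measurable_coe _ fun s hs => ?_
  simp only [massMeasure, Measure.sum_apply _ hs, Measure.smul_apply, smul_eq_mul]
  fun_prop

theorem measurable_valueLaw : Measurable valueLaw := by
  unfold valueLaw
  refine Measurable.ite ?_ measurable_massMeasure measurable_const
  exact ((Measure.measurable_coe MeasurableSet.univ).comp measurable_massMeasure)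
    (measurableSet_singleton 1)

theorem measurable_cutPoint : Measurable cutPoint := by
  unfold cutPoint
  fun_prop

/-- The conditional law of `(X_1, X_2, …)` given the cut points `y`: an i.i.d. sequence with
`P[X_1 ≤ k] = y_k`. -/
noncomputable def iidLaw (y : ℕ → ℝ) : Measure (ℕ → ℕ) :=
  Measure.infinitePi fun _ : ℕ => valueLaw y

instance isProbabilityMeasure_iidLaw (y : ℕ → ℝ) : IsProbabilityMeasure (iidLaw y) := by
  unfold iidLaw
  infer_instance

theorem measurable_iidLaw : Measurable iidLaw := by
  refine Measurable.measure_of_isPiSystem_of_isProbabilityMeasure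
    (generateFrom_squareCylinders (α := fun _ : ℕ => ℕ)).symm
    (isPiSystem_squareCylinders (fun _ => MeasurableSpace.isPiSystem_measurableSet)
      fun _ => by simp) ?_
  rintro _ ⟨s, t, ht, rfl⟩
  have ht' : ∀ i ∈ s, MeasurableSet (t i) := fun i _ => ht i (Set.mem_univ i)
  simp only [iidLaw, Measure.infinitePi_pi _ ht']
  exact Finset.measurable_prod _ fun i hi =>
    (Measure.measurable_coe (ht' i hi)).comp measurable_valueLaw

/-- The `GEM(α, θ)` exchangeable distribution: the unconditional law of `(X_1, X_2, …)`, obtained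
by first drawing the hazard rates from `hazardLaw α θ` and then, given the resulting cut points,
an i.i.d. sequence with law `iidLaw`. Coordinate `j` of the sequence is `X_{j+1}`. -/
noncomputable def exchangeableLaw (α θ : ℝ) : Measure (ℕ → ℕ) :=
  (hazardLaw α θ).bind fun h => iidLaw (cutPoint h)

/-- In the admissible range of the parameters the hazard rates have a probability law. -/
theorem isProbabilityMeasure_hazardLaw {α θ : ℝ} (h0 : 0 ≤ α) (h1 : α < 1) (hθ : -α < θ) :
    IsProbabilityMeasure (hazardLaw α θ) := by
  have (i : ℕ) : IsProbabilityMeasure (betaMeasure (1 - α) (θ + ((i : ℝ) + 1) * α)) :=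
    isProbabilityMeasureBeta (by linarith)
      (by nlinarith [mul_nonneg (Nat.cast_nonneg (α := ℝ) i) h0])
  unfold hazardLaw
  infer_instance

/-- In the admissible range of the parameters the exchangeable law is a probability measure. -/
theorem isProbabilityMeasure_exchangeableLaw {α θ : ℝ} (h0 : 0 ≤ α) (h1 : α < 1)
    (hθ : -α < θ) : IsProbabilityMeasure (exchangeableLaw α θ) := by
  have := isProbabilityMeasure_hazardLaw h0 h1 hθ
  have hm : Measurable fun h => iidLaw (cutPoint h) := measurable_iidLaw.comp measurable_cutPoint
  refine ⟨?_⟩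
  rw [exchangeableLaw, Measure.bind_apply MeasurableSet.univ hm.aemeasurable]
  simp

/-- `M_n = max (X_1, …, X_n)`, with `X_{j+1}` stored as `x j`. -/
def sampleMax (x : ℕ → ℕ) (n : ℕ) : ℕ := (Finset.range n).sup x

/-- `L_n`, the number of `j ≤ n` with `X_j = M_n`. -/
def numMax (x : ℕ → ℕ) (n : ℕ) : ℕ :=
  ∑ j ∈ Finset.range n, if x j = sampleMax x n then 1 else 0

end GEM

/-! Conditionally on the hazards, the sample is i.i.d. from a law `ν` on the positive integers with
`ν {k} / ν [k, ∞) = H_k`. Ignore values below `k`: each remaining value equals `k` with probability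
`H_k` and exceeds `k` otherwise. So `k` occurs at least `m` times before being exceeded with
probability `H_k ^ m`, and everything depends on whether `∑ H_k ^ m` converges.

If `∑ H_k ^ 2` converges, Borel–Cantelli excludes ties at all large levels
(`ae_limsup_numMax_eq_one`). If `∑ H_k ^ m` diverges, the probability that the multiplicity stays
below `m` is at most `∏ (1 - H_k ^ m) = 0`. This product comes from a first-step recursion
(`surviveProb_step`), so no independence between levels is needed.

For `α > 0`, `E[H_k ^ 2] = O(k⁻²)`, so the squares are a.s. summable, while `∑ E[H_k] = ∞` gives `∏
(1 - H_k) → 0`, so that no mass escapes to infinity. For `α = 0` the hazards are i.i.d. and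
positive, so a.s. no power of them is summable; the first power again gives `∏ (1 - H_k) → 0`. -/

namespace GEM

/-! ### The maximum and its multiplicity as a Markov chain -/

/-- The transition of the pair (current maximum, its multiplicity) when the value `a` is read. -/
def recordStep (s : ℕ × ℕ) (a : ℕ) : ℕ × ℕ :=
  if a < s.1 then s else if a = s.1 then (s.1, s.2 + 1) else (a, 1)

/-- The pair (maximum, multiplicity) after reading `x 0, …, x (n - 1)`, starting from `s`. -/
def recordState (s : ℕ × ℕ) (x : ℕ → ℕ) : ℕ → ℕ × ℕ
  | 0 => s
  | n + 1 => recordStep (recordState s x n) (x n)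

theorem sampleMax_succ (x : ℕ → ℕ) (n : ℕ) :
    sampleMax x (n + 1) = max (x n) (sampleMax x n) := by
  simp [sampleMax, Finset.range_add_one, Finset.sup_insert]

theorem le_sampleMax (x : ℕ → ℕ) {n i : ℕ} (h : i < n) : x i ≤ sampleMax x n :=
  Finset.le_sup (Finset.mem_range.2 h)

theorem numMax_eq_card (x : ℕ → ℕ) (n : ℕ) :
    numMax x n = ((Finset.range n).filter fun j => x j = sampleMax x n).card := by
  rw [numMax, Finset.card_filter]

theorem recordState_zero_eq (x : ℕ → ℕ) (n : ℕ) :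
    recordState (0, 0) x n = (sampleMax x n, numMax x n) := by
  induction n with
  | zero => simp [recordState, sampleMax, numMax]
  | succ n ih =>
    rw [recordState, ih, recordStep]
    rcases lt_trichotomy (x n) (sampleMax x n) with h | h | h
    · have hm : sampleMax x (n + 1) = sampleMax x n := by
        rw [sampleMax_succ, max_eq_right h.le]
      simp only [h, if_true, numMax, hm, Finset.sum_range_succ, h.ne, if_false, add_zero]
    · have hm : sampleMax x (n + 1) = sampleMax x n := by
        rw [sampleMax_succ, max_eq_right h.le]
      simp only [h, lt_irrefl, if_false, if_true, numMax, hm, Finset.sum_range_succ]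
    · have hm : sampleMax x (n + 1) = x n := by
        rw [sampleMax_succ, max_eq_left h.le]
      have h0 : ∀ j ∈ Finset.range n, (if x j = x n then 1 else 0) = 0 := fun j hj =>
        if_neg ((le_sampleMax x (Finset.mem_range.1 hj)).trans_lt h).ne
      simp only [not_lt_of_gt h, h.ne', if_false, numMax, hm, Finset.sum_range_succ,
        Finset.sum_eq_zero h0, if_true, zero_add]

/-- The sequence `a, x 0, x 1, …`. -/
def consSeq {β : Type*} (p : β × (ℕ → β)) : ℕ → β
  | 0 => p.1
  | n + 1 => p.2 n

theorem measurable_consSeq {β : Type*} [MeasurableSpace β] :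
    Measurable (consSeq : β × (ℕ → β) → ℕ → β) := by
  refine measurable_pi_lambda _ fun n => ?_
  cases n with
  | zero => exact measurable_fst
  | succ n => exact (measurable_pi_apply n).comp measurable_snd

/-- Prepending an independent coordinate preserves the i.i.d. law; this is what makes first-step
analysis possible. -/
theorem map_consSeq {β : Type*} [MeasurableSpace β] (ν : Measure β) [IsProbabilityMeasure ν] :
    (ν.prod (Measure.infinitePi fun _ : ℕ => ν)).map consSeq = Measure.infinitePi fun _ => ν := by
  classical
  refine Measure.eq_infinitePi _ fun s t ht => ?_
  obtain ⟨N, hN⟩ : ∃ N, s ⊆ Finset.range (N + 1) :=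
    ⟨s.sup id, fun i hi => Finset.mem_range.2 (Nat.lt_succ_of_le (Finset.le_sup (f := id) hi))⟩
  -- Padding with the whole space enlarges `s` to an initial segment, where coordinate `0` splits
  -- off.
  set t' : ℕ → Set β := fun i => if i ∈ s then t i else Set.univ with ht'
  have hm : ∀ i, MeasurableSet (t' i) := fun i => by
    by_cases h : i ∈ s <;> simp [ht', h, ht]
  have hset : consSeq ⁻¹' (Set.pi s t)
      = t' 0 ×ˢ Set.pi (Finset.range N : Set ℕ) (fun i => t' (i + 1)) := by
    ext p
    simp only [Set.mem_preimage, Set.mem_pi, Finset.mem_coe, Set.mem_prod, ht', Finset.mem_range]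
    constructor
    · intro h
      refine ⟨?_, fun i _ => ?_⟩
      · by_cases h0 : 0 ∈ s
        · simpa [h0, consSeq] using h 0 h0
        · simp [h0]
      · by_cases h0 : i + 1 ∈ s
        · simpa [h0, consSeq] using h (i + 1) h0
        · simp [h0]
    · rintro ⟨h0, h1⟩ i hi
      cases i with
      | zero => simpa [hi, consSeq] using h0
      | succ i =>
        have := h1 i (by simpa using hN hi)
        simpa [hi, consSeq] using this
  rw [Measure.map_apply measurable_consSeq
    (MeasurableSet.pi s.countable_toSet fun i _ => ht i), hset, Measure.prod_prod,
    Measure.infinitePi_pi _ (fun i _ => hm (i + 1)), mul_comm,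
    ← Finset.prod_range_succ' (fun i => ν (t' i)), ← Finset.prod_subset hN]
  · exact Finset.prod_congr rfl fun i hi => by simp [ht', hi]
  · intro i _ hi
    simp [ht', hi]

theorem recordState_consSeq (s : ℕ × ℕ) (a : ℕ) (x : ℕ → ℕ) (n : ℕ) :
    recordState s (consSeq (a, x)) (n + 1) = recordState (recordStep s a) x n := by
  induction n with
  | zero => rfl
  | succ n ih => rw [recordState, ih, recordState]; rfl

theorem measurable_recordState (s : ℕ × ℕ) (n : ℕ) :
    Measurable fun x : ℕ → ℕ => recordState s x n := by
  induction n with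
  | zero => exact measurable_const
  | succ n ih =>
    exact (measurable_of_countable fun p : (ℕ × ℕ) × ℕ => recordStep p.1 p.2).comp
      (ih.prodMk (measurable_pi_apply n))

/-- The sequences for which the multiplicity of the maximum, started from `s`, stays below `m`. -/
def surviveSet (m : ℕ) (s : ℕ × ℕ) : Set (ℕ → ℕ) := {x | ∀ n, (recordState s x n).2 < m}

theorem measurableSet_surviveSet (m : ℕ) (s : ℕ × ℕ) : MeasurableSet (surviveSet m s) := by
  have : surviveSet m s = ⋂ n, {x | (recordState s x n).2 < m} := by
    ext; simp [surviveSet]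
  rw [this]
  exact MeasurableSet.iInter fun n =>
    measurableSet_lt (measurable_snd.comp (measurable_recordState s n)) measurable_const

theorem consSeq_mem_surviveSet {m : ℕ} {s : ℕ × ℕ} (hs : s.2 < m) (a : ℕ) (x : ℕ → ℕ) :
    consSeq (a, x) ∈ surviveSet m s ↔ x ∈ surviveSet m (recordStep s a) := by
  refine ⟨fun h n => recordState_consSeq s a x n ▸ h (n + 1), fun h n => ?_⟩
  cases n with
  | zero => exact hs
  | succ n => rw [recordState_consSeq]; exact h n

/-! ### First-step analysis for a fixed law: unbounded multiplicity -/

section FixedLaw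

variable (ν : Measure ℕ)

/-- The probability that the multiplicity of the maximum, started from `s`, stays below `m`. -/
noncomputable def surviveProb (m : ℕ) (s : ℕ × ℕ) : ENNReal :=
  (Measure.infinitePi fun _ : ℕ => ν) (surviveSet m s)

theorem surviveProb_eq_zero_of_le {m : ℕ} {s : ℕ × ℕ} (h : m ≤ s.2) : surviveProb ν m s = 0 := by
  have : surviveSet m s = ∅ :=
    Set.eq_empty_of_forall_notMem fun x hx => absurd (hx 0) (not_lt.2 h)
  rw [surviveProb, this, measure_empty]

theorem setLIntegral_Ioi_surviveProb {m : ℕ} (k : ℕ) :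
    ∫⁻ a in Set.Ioi k, surviveProb ν m (a, 1) ∂ν = surviveProb ν m (k + 1, 1) * ν {k + 1}
      + ∫⁻ a in Set.Ioi (k + 1), surviveProb ν m (a, 1) ∂ν := by
  have : Set.Ioi k = {k + 1} ∪ Set.Ioi (k + 1) := by
    ext a
    simp only [Set.mem_Ioi, Set.mem_union, Set.mem_singleton_iff]
    omega
  rw [this, lintegral_union measurableSet_Ioi (by simp), lintegral_singleton]

/-- The discrete hazard rate of a law on `ℕ`. -/
noncomputable def hazard (k : ℕ) : ℝ := ν.real {k} / ν.real (Set.Ici k)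

theorem hazard_nonneg (k : ℕ) : 0 ≤ hazard ν k := by unfold hazard; positivity

variable [IsProbabilityMeasure ν]

theorem surviveProb_le_one (m : ℕ) (s : ℕ × ℕ) : surviveProb ν m s ≤ 1 := prob_le_one

theorem surviveProb_eq_lintegral {m : ℕ} {s : ℕ × ℕ} (hs : s.2 < m) :
    surviveProb ν m s = ∫⁻ a, surviveProb ν m (recordStep s a) ∂ν := by
  have hm := measurableSet_surviveSet m s
  rw [surviveProb, ← map_consSeq ν, Measure.map_apply measurable_consSeq hm,
    Measure.prod_apply (measurable_consSeq hm)]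
  refine lintegral_congr fun a => congrArg _ ?_
  ext x
  exact consSeq_mem_surviveSet hs a x

theorem surviveProb_split {m k l : ℕ} (hl : l < m) :
    surviveProb ν m (k, l) = surviveProb ν m (k, l) * ν (Set.Iio k)
      + (surviveProb ν m (k, l + 1) * ν {k} + ∫⁻ a in Set.Ioi k, surviveProb ν m (a, 1) ∂ν) := by
  conv_lhs => rw [surviveProb_eq_lintegral ν (s := (k, l)) hl]
  rw [← lintegral_add_compl _ (measurableSet_Iio (a := k)), Set.compl_Iio, ← Set.Ioi_insert,
    Set.insert_eq, lintegral_union measurableSet_Ioi (by simp)]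
  congr 1
  · rw [setLIntegral_congr_fun (g := fun _ => surviveProb ν m (k, l)) measurableSet_Iio,
      setLIntegral_const]
    intro a (ha : a < k)
    simp [recordStep, ha]
  · congr 1
    · rw [lintegral_singleton]
      simp [recordStep]
    · refine setLIntegral_congr_fun measurableSet_Ioi fun a (ha : k < a) => ?_
      simp [recordStep, ha.not_gt, ha.ne']

theorem hazard_le_one (k : ℕ) : hazard ν k ≤ 1 :=
  div_le_one_of_le₀ (measureReal_mono (by simp)) measureReal_nonneg

variable {ν}

/-- From `(k, l)`, values below `k` change nothing. The first value that is at least `k` equals `k`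
with probability `hazard ν k`; otherwise it is distributed as the first value that is at least `k +
1`, which is the first one to count from the fictitious state `(k + 1, 0)`. -/
theorem surviveProb_recursion (hν : ∀ k, ν.real (Set.Ici k) ≠ 0) {m k l : ℕ} (hl : l < m) :
    (surviveProb ν m (k, l)).toReal = hazard ν k * (surviveProb ν m (k, l + 1)).toReal
      + (1 - hazard ν k) * (surviveProb ν m (k + 1, 0)).toReal := by
  have hfin : ∀ s, surviveProb ν m s ≠ ⊤ := fun s =>
    ((surviveProb_le_one ν m s).trans_lt ENNReal.one_lt_top).ne
  have hI : ∀ k, ∫⁻ a in Set.Ioi k, surviveProb ν m (a, 1) ∂ν ≠ ⊤ := fun k => by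
    refine ((setLIntegral_mono measurable_const fun a _ =>
      surviveProb_le_one ν m (a, 1)).trans_lt ?_).ne
    rw [setLIntegral_const, one_mul]
    exact measure_lt_top _ _
  have key : ∀ k l, l < m → (surviveProb ν m (k, l)).toReal * ν.real (Set.Ici k)
      = (surviveProb ν m (k, l + 1)).toReal * ν.real {k}
        + (∫⁻ a in Set.Ioi k, surviveProb ν m (a, 1) ∂ν).toReal := fun k l hl => by
    have h := congrArg ENNReal.toReal (surviveProb_split ν (k := k) hl)
    rw [ENNReal.toReal_add (ENNReal.mul_ne_top (hfin _) (measure_ne_top _ _))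
      (ENNReal.add_ne_top.2 ⟨ENNReal.mul_ne_top (hfin _) (measure_ne_top _ _), hI k⟩),
      ENNReal.toReal_add (ENNReal.mul_ne_top (hfin _) (measure_ne_top _ _)) (hI k),
      ENNReal.toReal_mul, ENNReal.toReal_mul] at h
    have hc : ν.real (Set.Ici k) = 1 - ν.real (Set.Iio k) := by
      rw [← Set.compl_Iio, probReal_compl_eq_one_sub measurableSet_Iio]
    rw [hc]
    simp only [Measure.real] at h ⊢
    linarith
  have h1 := key k l hl
  -- With `h3`, this identifies the integral over values above `k` with the survival probability
  -- from `(k + 1, 0)` times `ν [k + 1, ∞)`.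
  have h2 := key (k + 1) 0 (by omega)
  have h3 := congrArg ENNReal.toReal (setLIntegral_Ioi_surviveProb ν (m := m) k)
  rw [ENNReal.toReal_add (ENNReal.mul_ne_top (hfin _) (measure_ne_top _ _)) (hI _),
    ENNReal.toReal_mul] at h3
  change _ = _ * ν.real {k + 1} + _ at h3
  have h4 : ν.real (Set.Ici k) = ν.real {k} + ν.real (Set.Ici (k + 1)) := by
    rw [← measureReal_union (by simp) measurableSet_Ici]
    congr 1
    ext a; simp; omega
  have hk := hν k
  unfold hazard
  field_simp
  rw [zero_add] at h2
  rw [h1, h3, ← h2, h4]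
  ring

theorem surviveProb_step (hν : ∀ k, ν.real (Set.Ici k) ≠ 0) (m k : ℕ) :
    (surviveProb ν m (k, 0)).toReal
      = (1 - hazard ν k ^ m) * (surviveProb ν m (k + 1, 0)).toReal := by
  -- Here `j` is the number of occurrences of `k` still missing; at `j = 0` survival has already
  -- failed.
  have : ∀ j ≤ m, (surviveProb ν m (k, m - j)).toReal
      = (1 - hazard ν k ^ j) * (surviveProb ν m (k + 1, 0)).toReal := by
    intro j
    induction j with
    | zero => intro _; simp [surviveProb_eq_zero_of_le]
    | succ j ih =>
      intro hj
      rw [surviveProb_recursion hν (by omega), show m - (j + 1) + 1 = m - j by omega,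
        ih (by omega)]
      ring
  simpa using this m le_rfl

theorem surviveProb_eq_zero (hν : ∀ k, ν.real (Set.Ici k) ≠ 0) {m : ℕ}
    (hm : ¬ Summable fun k => hazard ν k ^ m) : surviveProb ν m (0, 0) = 0 := by
  have hbound : ∀ K, (surviveProb ν m (0, 0)).toReal
      ≤ Real.exp (-∑ k ∈ Finset.range K, hazard ν k ^ m) := by
    intro K
    have h1 : (surviveProb ν m (0, 0)).toReal
        = (∏ k ∈ Finset.range K, (1 - hazard ν k ^ m)) * (surviveProb ν m (K, 0)).toReal := by
      induction K with
      | zero => simp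
      | succ K ih => rw [ih, surviveProb_step hν m K, Finset.prod_range_succ]; ring
    have h0 : ∀ k, 0 ≤ 1 - hazard ν k ^ m := fun k =>
      sub_nonneg.2 (pow_le_one₀ (hazard_nonneg ν k) (hazard_le_one ν k))
    rw [h1, ← Finset.sum_neg_distrib, Real.exp_sum]
    refine (mul_le_of_le_one_right (Finset.prod_nonneg fun k _ => h0 k) ?_).trans
      (Finset.prod_le_prod (fun k _ => h0 k) fun k _ => Real.one_sub_le_exp_neg _)
    exact ENNReal.toReal_mono ENNReal.one_ne_top (surviveProb_le_one ν m _)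
  have hlim := (not_summable_iff_tendsto_nat_atTop_of_nonneg
    fun k => pow_nonneg (hazard_nonneg ν k) m).1 hm
  have h0 := ge_of_tendsto' (Real.tendsto_exp_neg_atTop_nhds_zero.comp hlim) hbound
  have h1 := le_antisymm h0 ENNReal.toReal_nonneg
  exact ((ENNReal.toReal_eq_zero_iff _).1 h1).resolve_right
    ((surviveProb_le_one ν m _).trans_lt ENNReal.one_lt_top).ne

theorem numMax_le (x : ℕ → ℕ) (n : ℕ) : numMax x n ≤ n := by
  rw [numMax_eq_card]
  exact (Finset.card_filter_le _ _).trans (by simp)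

theorem limsup_numMax_eq_top {x : ℕ → ℕ} (h : ∀ m, ∃ n, m ≤ numMax x n) :
    limsup (fun n => (numMax x n : ℕ∞)) atTop = ⊤ := by
  refine ENat.eq_top_iff_forall_ge.2 fun m => le_limsup_of_frequently_le ?_
  refine frequently_atTop.2 fun N => ?_
  -- Since `numMax x n ≤ n`, multiplicity at least `N + 1` forces `n > N`; unboundedness therefore
  -- suffices.
  obtain ⟨n, hn⟩ := h (max m (N + 1))
  refine ⟨n, ?_, by exact_mod_cast (le_max_left _ _).trans hn⟩
  have := numMax_le x n
  omega

/-- If no power of the hazard rates is summable, the multiplicity of the maximum of an i.i.d.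
sample is almost surely unbounded. -/
theorem ae_limsup_numMax_eq_top (hν : ∀ k, ν.real (Set.Ici k) ≠ 0)
    (hm : ∀ m, ¬ Summable fun k => hazard ν k ^ m) :
    ∀ᵐ x ∂Measure.infinitePi fun _ : ℕ => ν,
      limsup (fun n => (numMax x n : ℕ∞)) atTop = ⊤ := by
  have : ∀ᵐ x ∂Measure.infinitePi fun _ : ℕ => ν, ∀ m, x ∉ surviveSet m (0, 0) :=
    ae_all_iff.2 fun m => measure_eq_zero_iff_ae_notMem.1 (surviveProb_eq_zero hν (hm m))
  filter_upwards [this] with x hx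
  refine limsup_numMax_eq_top fun m => ?_
  have := hx m
  simpa [surviveSet, recordState_zero_eq] using this

end FixedLaw
-- Ties at the maximum: Borel–Cantelli for a fixed law
/-- The sequences whose first two occurrences of `k` are at `i` and `i + 1 + d`, all other values
up to then being smaller than `k`. -/
def tieSet (k i d : ℕ) : Set (ℕ → ℕ) :=
  Set.pi (Finset.range (i + 1 + d + 1) : Set ℕ)
    fun l => if l = i ∨ l = i + 1 + d then {k} else Set.Iio k

theorem mem_tieSet_of_two_le_numMax {x : ℕ → ℕ} {n : ℕ} (h : 2 ≤ numMax x n) :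
    ∃ i d, x ∈ tieSet (sampleMax x n) i d := by
  classical
  set k := sampleMax x n with hk
  rw [numMax_eq_card] at h
  obtain ⟨a, ha, b, hb, hab⟩ := Finset.one_lt_card.1 h
  simp only [Finset.mem_filter, Finset.mem_range] at ha hb
  wlog hlt : a < b generalizing a b
  · exact this b a hab.symm hb ha (by omega)
  have hex : ∃ i, x i = k := ⟨a, ha.2⟩
  set i := Nat.find hex with hi
  have hia : i ≤ a := Nat.find_min' hex ha.2
  have hex' : ∃ d, x (i + 1 + d) = k := ⟨b - i - 1, by
    rw [show i + 1 + (b - i - 1) = b by omega]; exact hb.2⟩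
  set d := Nat.find hex' with hd
  have hdb : d ≤ b - i - 1 := Nat.find_min' hex' (by
    rw [show i + 1 + (b - i - 1) = b by omega]; exact hb.2)
  refine ⟨i, d, fun l hl => ?_⟩
  simp only [Finset.coe_range, Set.mem_Iio] at hl
  beta_reduce
  split_ifs with hc
  · rcases hc with rfl | rfl
    · exact Nat.find_spec hex
    · exact Nat.find_spec hex'
  · push Not at hc
    refine lt_of_le_of_ne (le_sampleMax x (by omega)) fun hxl => ?_
    rcases lt_or_ge l i with h1 | h1
    · exact Nat.find_min hex h1 hxl
    · refine Nat.find_min hex' (m := l - i - 1) (by omega) ?_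
      rwa [show i + 1 + (l - i - 1) = l by omega]

theorem one_le_numMax (x : ℕ → ℕ) {n : ℕ} (hn : 0 < n) : 1 ≤ numMax x n := by
  rw [numMax_eq_card, Nat.one_le_iff_ne_zero, ← Nat.pos_iff_ne_zero, Finset.card_pos]
  obtain ⟨j, hj, h⟩ := Finset.exists_mem_eq_sup (Finset.range n) ⟨0, by simpa using hn⟩ x
  exact ⟨j, Finset.mem_filter.2 ⟨hj, h.symm⟩⟩

theorem limsup_numMax_eq_one {x : ℕ → ℕ} (h : ∀ᶠ n in atTop, numMax x n ≤ 1) :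
    limsup (fun n => (numMax x n : ℕ∞)) atTop = 1 := by
  have : (fun n => (numMax x n : ℕ∞)) =ᶠ[atTop] fun _ => 1 := by
    filter_upwards [h, eventually_gt_atTop 0] with n h1 h2
    have := le_antisymm h1 (one_le_numMax x h2)
    simp [this]
  rw [limsup_congr this, limsup_const]

section FixedLaw

variable {ν : Measure ℕ} [IsProbabilityMeasure ν]

theorem infinitePi_tieSet (k i d : ℕ) :
    (Measure.infinitePi fun _ : ℕ => ν) (tieSet k i d)
      = ν (Set.Iio k) ^ i * ν (Set.Iio k) ^ d * ν {k} ^ 2 := by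
  rw [tieSet, Measure.infinitePi_pi _ fun _ _ => MeasurableSet.of_discrete,
    Finset.prod_range_succ, Finset.prod_range_add, Finset.prod_range_succ,
    Finset.prod_congr rfl (g := fun _ => ν (Set.Iio k)),
    Finset.prod_congr (s₁ := Finset.range d) rfl (g := fun _ => ν (Set.Iio k))]
  · simp
    ring
  · intro l hl
    have := Finset.mem_range.1 hl
    rw [if_neg (by omega)]
  · intro l hl
    have := Finset.mem_range.1 hl
    rw [if_neg (by omega)]

theorem one_sub_measure_Iio (k : ℕ) : 1 - ν (Set.Iio k) = ν (Set.Ici k) := by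
  rw [← Set.compl_Iio, prob_compl_eq_one_sub measurableSet_Iio]

/-- Union bound over the positions of the first two occurrences: each of the two geometric series
sums to `1 / ν [k, ∞)`. -/
theorem infinitePi_iUnion_tieSet_le (hν : ∀ k, ν.real (Set.Ici k) ≠ 0) (k : ℕ) :
    (Measure.infinitePi fun _ : ℕ => ν) (⋃ i, ⋃ d, tieSet k i d)
      ≤ ENNReal.ofReal (hazard ν k ^ 2) := by
  calc (Measure.infinitePi fun _ : ℕ => ν) (⋃ i, ⋃ d, tieSet k i d)
      ≤ ∑' i, ∑' d, ν (Set.Iio k) ^ i * ν (Set.Iio k) ^ d * ν {k} ^ 2 :=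
        (measure_iUnion_le _).trans (ENNReal.tsum_le_tsum fun i =>
          (measure_iUnion_le _).trans (ENNReal.tsum_le_tsum fun d => (infinitePi_tieSet k i d).le))
    _ = (ν {k} / ν (Set.Ici k)) ^ 2 := by
        simp_rw [mul_assoc, ENNReal.tsum_mul_left, ENNReal.tsum_mul_right, ENNReal.tsum_geometric,
          one_sub_measure_Iio]
        rw [div_eq_mul_inv]
        ring
    _ = ENNReal.ofReal (hazard ν k ^ 2) := by
        rw [ENNReal.ofReal_pow (hazard_nonneg ν k), hazard,
          ENNReal.ofReal_div_of_pos (lt_of_le_of_ne measureReal_nonneg (hν k).symm),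
          ofReal_measureReal, ofReal_measureReal]

/-- Ensures that the running maximum passes the level beyond which ties are excluded. -/
theorem ae_exists_ge (hν : ∀ k, ν.real (Set.Ici k) ≠ 0) (k : ℕ) :
    ∀ᵐ x ∂Measure.infinitePi fun _ : ℕ => ν, ∃ j, k ≤ x j := by
  have hlt : ν (Set.Iio k) < 1 := by
    have h : ν (Set.Ici k) ≠ 0 := fun h => hν k (by simp [Measure.real, h])
    rw [← one_sub_measure_Iio] at h
    exact tsub_pos_iff_lt.1 (pos_iff_ne_zero.2 h)
  rw [ae_iff]
  refine le_antisymm (ge_of_tendsto' (ENNReal.tendsto_pow_atTop_nhds_zero_of_lt_one hlt)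
    fun n => ?_) zero_le
  calc _ ≤ (Measure.infinitePi fun _ : ℕ => ν)
        (Set.pi (Finset.range n : Set ℕ) fun _ => Set.Iio k) :=
        measure_mono fun x (hx : ¬∃ j, k ≤ x j) j _ => not_le.1 fun h => hx ⟨j, h⟩
    _ = ν (Set.Iio k) ^ n := by
        rw [Measure.infinitePi_pi _ fun _ _ => MeasurableSet.of_discrete]
        simp

/-- If the squared hazard rates are summable, the maximum of an i.i.d. sample is almost surely
eventually unique. -/
theorem ae_limsup_numMax_eq_one (hν : ∀ k, ν.real (Set.Ici k) ≠ 0)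
    (hs : Summable fun k => hazard ν k ^ 2) :
    ∀ᵐ x ∂Measure.infinitePi fun _ : ℕ => ν,
      limsup (fun n => (numMax x n : ℕ∞)) atTop = 1 := by
  have hbc := ae_eventually_notMem (μ := Measure.infinitePi fun _ : ℕ => ν)
    (s := fun k => ⋃ i, ⋃ d, tieSet k i d)
    ((ENNReal.tsum_le_tsum (infinitePi_iUnion_tieSet_le hν)).trans_lt
      hs.tsum_ofReal_lt_top).ne
  filter_upwards [hbc, ae_all_iff.2 (ae_exists_ge hν)] with x hx hge
  obtain ⟨K, hK⟩ := eventually_atTop.1 hx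
  obtain ⟨j, hj⟩ := hge K
  refine limsup_numMax_eq_one ?_
  filter_upwards [eventually_gt_atTop j] with n hn
  by_contra! h
  obtain ⟨i, d, hid⟩ := mem_tieSet_of_two_le_numMax h
  exact hK _ (hj.trans (le_sampleMax x hn)) (Set.mem_iUnion₂.2 ⟨i, d, hid⟩)

end FixedLaw

/-! ### The law determined by the cut points and its hazard rates -/

section CutPoints

variable {h : ℕ → ℝ}

theorem cutPoint_succ_sub (h : ℕ → ℝ) (k : ℕ) :
    cutPoint h (k + 1) - cutPoint h k = h k * ∏ i ∈ Finset.range k, (1 - h i) := by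
  rw [cutPoint, cutPoint, Finset.prod_range_succ]
  ring

/-- The increments telescope, and `hp` says that nothing is lost at infinity. -/
theorem massMeasure_Ici_succ (hh : ∀ i, h i ∈ Set.Ioo (0 : ℝ) 1)
    (hp : Tendsto (fun n => ∏ i ∈ Finset.range n, (1 - h i)) atTop (nhds 0)) (k : ℕ) :
    massMeasure (cutPoint h) (Set.Ici (k + 1))
      = ENNReal.ofReal (∏ i ∈ Finset.range k, (1 - h i)) := by
  have hpos : ∀ n, 0 < ∏ i ∈ Finset.range n, (1 - h i) := fun n =>
    Finset.prod_pos fun i _ => by linarith [(hh i).2]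
  have h0 : ∀ n, 0 ≤ cutPoint h (n + 1) - cutPoint h n := fun n => by
    rw [cutPoint_succ_sub]
    exact mul_nonneg (hh n).1.le (hpos n).le
  have hsum : HasSum (fun n => cutPoint h (n + k + 1) - cutPoint h (n + k))
      (∏ i ∈ Finset.range k, (1 - h i)) := by
    rw [hasSum_iff_tendsto_nat_of_nonneg fun n => h0 (n + k)]
    have : ∀ n, ∑ i ∈ Finset.range n, (cutPoint h (i + k + 1) - cutPoint h (i + k))
        = (∏ i ∈ Finset.range k, (1 - h i)) - ∏ i ∈ Finset.range (n + k), (1 - h i) := fun n => by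
      have := Finset.sum_range_sub (fun i => cutPoint h (i + k)) n
      simp only [add_right_comm _ 1 k] at this
      rw [this, cutPoint, cutPoint, zero_add]
      ring
    simp_rw [this]
    simpa using ((tendsto_add_atTop_iff_nat k).2 hp).const_sub _
  have hterm : ∀ n : ℕ, (ENNReal.ofReal (cutPoint h (n + 1) - cutPoint h n)
      • Measure.dirac (n + 1)) (Set.Ici (k + 1))
        = if k ≤ n then ENNReal.ofReal (cutPoint h (n + 1) - cutPoint h n) else 0 := fun n => by
    by_cases hkn : k ≤ n <;> simp [hkn]
  rw [massMeasure, Measure.sum_apply _ measurableSet_Ici, tsum_congr hterm, ← hsum.tsum_eq]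
  refine Eq.trans ?_ (ENNReal.ofReal_tsum_of_nonneg (fun n => h0 (n + k)) hsum.summable).symm
  refine (ENNReal.summable.sum_add_tsum_nat_add' (k := k)).symm.trans ?_
  rw [Finset.sum_eq_zero fun i hi => if_neg (not_le.2 (Finset.mem_range.1 hi)), zero_add]
  exact tsum_congr fun n => if_pos (Nat.le_add_left k n)

theorem massMeasure_singleton_succ (y : ℕ → ℝ) (k : ℕ) :
    massMeasure y {k + 1} = ENNReal.ofReal (y (k + 1) - y k) := by
  rw [massMeasure, Measure.sum_apply _ (measurableSet_singleton _), tsum_eq_single k]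
  · simp
  · intro j hj
    simp [hj]

theorem massMeasure_singleton_zero (y : ℕ → ℝ) : massMeasure y {0} = 0 := by
  simp [massMeasure, Measure.sum_apply _ (measurableSet_singleton _)]

theorem valueLaw_cutPoint (hh : ∀ i, h i ∈ Set.Ioo (0 : ℝ) 1)
    (hp : Tendsto (fun n => ∏ i ∈ Finset.range n, (1 - h i)) atTop (nhds 0)) :
    valueLaw (cutPoint h) = massMeasure (cutPoint h) := by
  have hu : (Set.univ : Set ℕ) = {0} ∪ Set.Ici 1 := by
    ext a
    simp only [Set.mem_univ, Set.mem_union, Set.mem_singleton_iff, Set.mem_Ici, true_iff]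
    omega
  rw [valueLaw, if_pos]
  rw [hu, measure_union (by simp) measurableSet_Ici, massMeasure_singleton_zero, zero_add,
    ← zero_add 1, massMeasure_Ici_succ hh hp]
  simp

theorem valueLaw_cutPoint_real_Ici_ne_zero (hh : ∀ i, h i ∈ Set.Ioo (0 : ℝ) 1)
    (hp : Tendsto (fun n => ∏ i ∈ Finset.range n, (1 - h i)) atTop (nhds 0)) (k : ℕ) :
    (valueLaw (cutPoint h)).real (Set.Ici k) ≠ 0 := by
  have hpos : 0 < (valueLaw (cutPoint h)).real (Set.Ici (k + 1)) := by
    have : 0 < ∏ i ∈ Finset.range k, (1 - h i) :=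
      Finset.prod_pos fun i _ => by linarith [(hh i).2]
    rwa [valueLaw_cutPoint hh hp, Measure.real, massMeasure_Ici_succ hh hp,
      ENNReal.toReal_ofReal this.le]
  exact (hpos.trans_le (measureReal_mono (Set.Ici_subset_Ici.2 k.le_succ))).ne'

theorem hazard_valueLaw_succ (hh : ∀ i, h i ∈ Set.Ioo (0 : ℝ) 1)
    (hp : Tendsto (fun n => ∏ i ∈ Finset.range n, (1 - h i)) atTop (nhds 0)) (k : ℕ) :
    hazard (valueLaw (cutPoint h)) (k + 1) = h k := by
  have hpos : 0 < ∏ i ∈ Finset.range k, (1 - h i) :=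
    Finset.prod_pos fun i _ => by linarith [(hh i).2]
  rw [hazard, valueLaw_cutPoint hh hp, Measure.real, Measure.real, massMeasure_Ici_succ hh hp,
    massMeasure_singleton_succ, cutPoint_succ_sub, ENNReal.toReal_ofReal hpos.le,
    ENNReal.toReal_ofReal (mul_nonneg (hh k).1.le hpos.le), mul_div_cancel_right₀ _ hpos.ne']

theorem summable_hazard_valueLaw_pow (hh : ∀ i, h i ∈ Set.Ioo (0 : ℝ) 1)
    (hp : Tendsto (fun n => ∏ i ∈ Finset.range n, (1 - h i)) atTop (nhds 0)) (m : ℕ) :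
    (Summable fun k => hazard (valueLaw (cutPoint h)) k ^ m) ↔ Summable fun k => h k ^ m := by
  -- Values start at `1`, so `h k` is the hazard at `k + 1`; the single term at `0` does not affect
  -- summability.
  rw [← summable_nat_add_iff 1]
  simp_rw [hazard_valueLaw_succ hh hp]

end CutPoints

/-! ### Moments of the beta distribution -/

section Beta

variable {a b : ℝ}

theorem beta_add_one_left (ha : 0 < a) (hb : 0 < b) :
    beta (a + 1) b = a / (a + b) * beta a b := by
  have h : Real.Gamma (a + b) ≠ 0 := (Real.Gamma_pos_of_pos (add_pos ha hb)).ne'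
  have hab : a + b ≠ 0 := (add_pos ha hb).ne'
  rw [beta, beta, Real.Gamma_add_one ha.ne', show a + 1 + b = a + b + 1 by ring,
    Real.Gamma_add_one hab]
  field_simp

theorem beta_add_one_right (ha : 0 < a) (hb : 0 < b) :
    beta a (b + 1) = b / (a + b) * beta a b := by
  have h : Real.Gamma (a + b) ≠ 0 := (Real.Gamma_pos_of_pos (add_pos ha hb)).ne'
  have hab : a + b ≠ 0 := (add_pos ha hb).ne'
  rw [beta, beta, Real.Gamma_add_one hb.ne', ← add_assoc, Real.Gamma_add_one hab]
  field_simp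

/-- Size-biasing raises the first parameter by one, so moments reduce to total masses of other beta
laws. -/
theorem betaPDF_mul_ofReal (ha : 0 < a) (hb : 0 < b) (x : ℝ) :
    betaPDF a b x * ENNReal.ofReal x = ENNReal.ofReal (a / (a + b)) * betaPDF (a + 1) b x := by
  by_cases hx : 0 < x ∧ x < 1
  · have := beta_pos ha hb
    have h1 : 0 < a + b := add_pos ha hb
    rw [betaPDF_of_pos_lt_one hx.1 hx.2, betaPDF_of_pos_lt_one hx.1 hx.2,
      ← ENNReal.ofReal_mul' hx.1.le, ← ENNReal.ofReal_mul (by positivity),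
      beta_add_one_left ha hb, add_sub_cancel_right, Real.rpow_sub_one hx.1.ne']
    congr 1
    have := hx.1
    field_simp
  · simp [betaPDF_eq, hx]

theorem betaPDF_mul_ofReal_one_sub (ha : 0 < a) (hb : 0 < b) (x : ℝ) :
    betaPDF a b x * ENNReal.ofReal (1 - x)
      = ENNReal.ofReal (b / (a + b)) * betaPDF a (b + 1) x := by
  by_cases hx : 0 < x ∧ x < 1
  · have := beta_pos ha hb
    have h1 : 0 < a + b := add_pos ha hb
    have h2 : 0 < 1 - x := sub_pos.2 hx.2
    rw [betaPDF_of_pos_lt_one hx.1 hx.2, betaPDF_of_pos_lt_one hx.1 hx.2,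
      ← ENNReal.ofReal_mul' h2.le, ← ENNReal.ofReal_mul (by positivity),
      beta_add_one_right ha hb, add_sub_cancel_right, Real.rpow_sub_one h2.ne']
    congr 1
    field_simp
  · simp [betaPDF_eq, hx]

theorem measurable_betaPDF (a b : ℝ) : Measurable (betaPDF a b) :=
  (measurable_betaPDFReal a b).ennreal_ofReal

theorem lintegral_ofReal_mul_betaMeasure (ha : 0 < a) (hb : 0 < b) {f : ℝ → ENNReal}
    (hf : Measurable f) : ∫⁻ x, ENNReal.ofReal x * f x ∂betaMeasure a b
      = ENNReal.ofReal (a / (a + b)) * ∫⁻ x, f x ∂betaMeasure (a + 1) b := by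
  rw [betaMeasure, betaMeasure,
    lintegral_withDensity_eq_lintegral_mul _ (measurable_betaPDF a b) (by fun_prop),
    lintegral_withDensity_eq_lintegral_mul _ (measurable_betaPDF (a + 1) b) hf,
    ← lintegral_const_mul _ ((measurable_betaPDF (a + 1) b).mul hf)]
  refine lintegral_congr fun x => ?_
  simp only [Pi.mul_apply]
  rw [← mul_assoc, betaPDF_mul_ofReal ha hb, mul_assoc]

theorem lintegral_ofReal_sq_betaMeasure (ha : 0 < a) (hb : 0 < b) :
    ∫⁻ x, ENNReal.ofReal x ^ 2 ∂betaMeasure a b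
      = ENNReal.ofReal (a / (a + b) * ((a + 1) / (a + 1 + b))) := by
  have ha1 : 0 < a + 1 := by linarith
  have := isProbabilityMeasureBeta (add_pos ha1 one_pos) hb
  have h2 := lintegral_ofReal_mul_betaMeasure ha1 hb (f := fun _ => 1) measurable_const
  simp only [mul_one, lintegral_const, measure_univ] at h2
  simp_rw [sq]
  rw [lintegral_ofReal_mul_betaMeasure ha hb ENNReal.measurable_ofReal, h2,
    ENNReal.ofReal_mul (by positivity)]

theorem lintegral_ofReal_one_sub_betaMeasure (ha : 0 < a) (hb : 0 < b) :
    ∫⁻ x, ENNReal.ofReal (1 - x) ∂betaMeasure a b = ENNReal.ofReal (b / (a + b)) := by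
  rw [betaMeasure,
    lintegral_withDensity_eq_lintegral_mul _ (measurable_betaPDF a b) (by fun_prop)]
  simp only [Pi.mul_apply, betaPDF_mul_ofReal_one_sub ha hb]
  rw [lintegral_const_mul _ (measurable_betaPDF _ _),
    lintegral_betaPDF_eq_one ha (by linarith), mul_one]

theorem ae_betaMeasure_mem_Ioo (a b : ℝ) : ∀ᵐ x ∂betaMeasure a b, x ∈ Set.Ioo (0 : ℝ) 1 := by
  rw [betaMeasure, ae_withDensity_iff (measurable_betaPDF a b)]
  refine ae_of_all _ fun x hx => ?_
  by_contra h
  have h' : ¬(0 < x ∧ x < 1) := h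
  exact hx (by simp [betaPDF_eq, h'])

end Beta

/-! ### Almost sure convergence and divergence for independent hazards -/

section ProductLaw

variable {μ : ℕ → Measure ℝ} [∀ i, IsProbabilityMeasure (μ i)]

theorem ae_infinitePi_mem_Ioo (hμ : ∀ i, ∀ᵐ x ∂μ i, x ∈ Set.Ioo (0 : ℝ) 1) :
    ∀ᵐ h ∂Measure.infinitePi μ, ∀ i, h i ∈ Set.Ioo (0 : ℝ) 1 :=
  ae_all_iff.2 fun i =>
    (measurePreserving_eval_infinitePi μ i).quasiMeasurePreserving.ae (hμ i)

theorem lintegral_infinitePi_eval (i : ℕ) {f : ℝ → ENNReal} (hf : Measurable f) :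
    ∫⁻ h, f (h i) ∂Measure.infinitePi μ = ∫⁻ x, f x ∂μ i :=
  (measurePreserving_eval_infinitePi μ i).lintegral_comp hf

/-- The partial products decrease, and by independence their expectations tend to `0`; hence their
infimum has expectation `0` and vanishes a.s. -/
theorem ae_tendsto_prod_one_sub (hμ : ∀ i, ∀ᵐ x ∂μ i, x ∈ Set.Ioo (0 : ℝ) 1)
    (hlim : Tendsto (fun n => ∏ i ∈ Finset.range n, ∫⁻ x, ENNReal.ofReal (1 - x) ∂μ i)
      atTop (nhds 0)) :
    ∀ᵐ h ∂Measure.infinitePi μ,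
      Tendsto (fun n => ∏ i ∈ Finset.range n, (1 - h i)) atTop (nhds 0) := by
  have hind := iIndepFun_infinitePi (P := μ) (X := fun _ x => ENNReal.ofReal (1 - x))
    fun _ => by fun_prop
  have hprod : ∀ n, ∫⁻ h, ∏ i ∈ Finset.range n, ENNReal.ofReal (1 - h i) ∂Measure.infinitePi μ
      = ∏ i ∈ Finset.range n, ∫⁻ x, ENNReal.ofReal (1 - x) ∂μ i := fun n => by
    rw [lintegral_prod_eq_prod_lintegral_of_indepFun _ _ hind fun _ => by fun_prop]
    exact Finset.prod_congr rfl fun i _ =>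
      lintegral_infinitePi_eval i (f := fun x => ENNReal.ofReal (1 - x)) (by fun_prop)
  have hinf : ∫⁻ h, ⨅ n, ∏ i ∈ Finset.range n, ENNReal.ofReal (1 - h i)
      ∂Measure.infinitePi μ = 0 :=
    le_antisymm (ge_of_tendsto' hlim fun n =>
      (lintegral_mono fun h => iInf_le _ n).trans (hprod n).le) zero_le
  rw [lintegral_eq_zero_iff (by fun_prop)] at hinf
  filter_upwards [hinf, ae_infinitePi_mem_Ioo hμ] with h h0 hh
  have hanti : Antitone fun n => ∏ i ∈ Finset.range n, ENNReal.ofReal (1 - h i) :=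
    antitone_nat_of_succ_le fun n => by
      rw [Finset.prod_range_succ]
      exact mul_le_of_le_one_right' (ENNReal.ofReal_le_one.2 (by linarith [(hh n).1]))
  have ht := tendsto_atTop_iInf hanti
  rw [show ⨅ n, ∏ i ∈ Finset.range n, ENNReal.ofReal (1 - h i) = 0 from h0] at ht
  have hpos : ∀ i, 0 ≤ 1 - h i := fun i => by linarith [(hh i).2]
  simp_rw [← ENNReal.ofReal_prod_of_nonneg fun i _ => hpos i] at ht
  have := (ENNReal.tendsto_toReal ENNReal.zero_ne_top).comp ht
  simpa [Function.comp_def, ENNReal.toReal_ofReal, Finset.prod_nonneg, hpos] using this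

theorem ae_summable_sq (hμ : ∀ i, ∀ᵐ x ∂μ i, x ∈ Set.Ioo (0 : ℝ) 1)
    (hs : ∑' i, ∫⁻ x, ENNReal.ofReal x ^ 2 ∂μ i ≠ ⊤) :
    ∀ᵐ h ∂Measure.infinitePi μ, Summable fun i => h i ^ 2 := by
  have hsum : ∫⁻ h, ∑' i, ENNReal.ofReal (h i) ^ 2 ∂Measure.infinitePi μ ≠ ⊤ := by
    rw [lintegral_tsum fun i => Measurable.aemeasurable (by fun_prop)]
    convert hs using 3 with i
    exact lintegral_infinitePi_eval i (f := fun x => ENNReal.ofReal x ^ 2) (by fun_prop)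
  filter_upwards [ae_lt_top (by fun_prop) hsum, ae_infinitePi_mem_Ioo hμ] with h h0 hh
  have := ENNReal.summable_toReal h0.ne
  simpa [ENNReal.toReal_ofReal (hh _).1.le] using this

/-- Some `ε > 0` has `ρ (ε, ∞) > 0`. By the second Borel–Cantelli lemma `h i > ε` infinitely often,
so no power of `h i` tends to `0`. -/
theorem ae_not_summable_pow {ρ : Measure ℝ} [IsProbabilityMeasure ρ]
    (hρ : ∀ᵐ x ∂ρ, x ∈ Set.Ioo (0 : ℝ) 1) :
    ∀ᵐ h ∂Measure.infinitePi fun _ : ℕ => ρ, ∀ m : ℕ, ¬ Summable fun i => h i ^ m := by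
  obtain ⟨ε, hε, hpos⟩ : ∃ ε : ℝ, 0 < ε ∧ ρ (Set.Ioi ε) ≠ 0 := by
    by_contra! hcon
    have : ρ (⋃ n : ℕ, Set.Ioi (1 / ((n : ℝ) + 1))) = 0 :=
      measure_iUnion_null fun n => hcon _ (by positivity)
    have hfalse : ∀ᵐ _ ∂ρ, False := by
      filter_upwards [hρ, measure_eq_zero_iff_ae_notMem.1 this] with x hx hx'
      obtain ⟨n, hn⟩ := exists_nat_one_div_lt hx.1
      exact hx' (Set.mem_iUnion.2 ⟨n, hn⟩)
    exact hfalse.exists.elim fun _ h => h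
  have hind : iIndepSet (fun i : ℕ => {h : ℕ → ℝ | ε < h i}) (Measure.infinitePi fun _ => ρ) := by
    have := iIndepFun_infinitePi (P := fun _ : ℕ => ρ) (X := fun _ x => x) fun _ => measurable_id
    rw [iIndepFun_iff_measure_inter_preimage_eq_mul] at this
    rw [iIndepSet_iff_meas_biInter fun i => measurableSet_lt measurable_const (by fun_prop)]
    exact fun s => this s (sets := fun _ => Set.Ioi ε) fun _ _ => measurableSet_Ioi
  have hlim := measure_limsup_eq_one
    (fun i => measurableSet_lt measurable_const (by fun_prop)) hind (by
      have : ∀ i, (Measure.infinitePi fun _ : ℕ => ρ) {h : ℕ → ℝ | ε < h i} = ρ (Set.Ioi ε) :=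
        fun i => (measurePreserving_eval_infinitePi (fun _ : ℕ => ρ) i).measure_preimage
          measurableSet_Ioi.nullMeasurableSet
      simp_rw [this]
      exact ENNReal.tsum_const_eq_top_of_ne_zero hpos)
  filter_upwards [(prob_compl_eq_zero_iff (MeasurableSet.measurableSet_limsup fun i =>
    measurableSet_lt measurable_const (by fun_prop))).2 hlim |> measure_eq_zero_iff_ae_notMem.1]
    with h hh m hsum
  rw [Set.notMem_compl_iff, mem_limsup_iff_frequently_mem] at hh
  refine hh ((hsum.tendsto_atTop_zero.eventually_lt_const (pow_pos hε m)).mono fun i hi hlt => ?_)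
  exact hi.not_ge (pow_le_pow_left₀ hε.le (le_of_lt hlt) m)

end ProductLaw

theorem tendsto_prod_one_sub_of_not_summable {u : ℕ → ℝ} (h0 : ∀ i, 0 ≤ u i) (h1 : ∀ i, u i ≤ 1)
    (hu : ¬ Summable u) : Tendsto (fun n => ∏ i ∈ Finset.range n, (1 - u i)) atTop (nhds 0) := by
  refine squeeze_zero (fun n => Finset.prod_nonneg fun i _ => sub_nonneg.2 (h1 i)) (fun n => ?_)
    (Real.tendsto_exp_neg_atTop_nhds_zero.comp
      ((not_summable_iff_tendsto_nat_atTop_of_nonneg h0).1 hu))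
  rw [Function.comp_apply, ← Finset.sum_neg_distrib, Real.exp_sum]
  exact Finset.prod_le_prod (fun i _ => sub_nonneg.2 (h1 i))
    fun i _ => Real.one_sub_le_exp_neg _

/-! ### The hazards of the GEM law -/

section HazardLaw

variable {α θ : ℝ}

theorem betaParam_pos (h0 : 0 ≤ α) (hθ : -α < θ) (i : ℕ) : 0 < θ + ((i : ℝ) + 1) * α := by
  nlinarith [mul_nonneg (Nat.cast_nonneg (α := ℝ) i) h0]

theorem ae_hazardLaw_mem_Ioo (h0 : 0 ≤ α) (h1 : α < 1) (hθ : -α < θ) :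
    ∀ᵐ h ∂hazardLaw α θ, ∀ i, h i ∈ Set.Ioo (0 : ℝ) 1 := by
  have (i : ℕ) : IsProbabilityMeasure (betaMeasure (1 - α) (θ + ((i : ℝ) + 1) * α)) :=
    isProbabilityMeasureBeta (sub_pos.2 h1) (betaParam_pos h0 hθ i)
  exact ae_infinitePi_mem_Ioo fun i => ae_betaMeasure_mem_Ioo _ _

theorem ae_hazardLaw_tendsto_prod (h0 : 0 < α) (h1 : α < 1) (hθ : -α < θ) :
    ∀ᵐ h ∂hazardLaw α θ, Tendsto (fun n => ∏ i ∈ Finset.range n, (1 - h i)) atTop (nhds 0) := by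
  have ha : 0 < 1 - α := sub_pos.2 h1
  have hb := betaParam_pos h0.le hθ
  have (i : ℕ) : IsProbabilityMeasure (betaMeasure (1 - α) (θ + ((i : ℝ) + 1) * α)) :=
    isProbabilityMeasureBeta ha (hb i)
  refine ae_tendsto_prod_one_sub (fun i => ae_betaMeasure_mem_Ioo _ _) ?_
  set u : ℕ → ℝ := fun i => (1 - α) / (1 - α + (θ + ((i : ℝ) + 1) * α)) with hu
  have hu0 : ∀ i, 0 ≤ u i := fun i => div_nonneg ha.le (add_pos ha (hb i)).le
  have hu1 : ∀ i, u i ≤ 1 := fun i =>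
    div_le_one_of_le₀ (by linarith [hb i]) (add_pos ha (hb i)).le
  have hu' : ¬ Summable u := fun hs => by
    -- Harmonic comparison: the denominator `1 + θ + i α` of `u i` is at most `(1 + |θ| + α) (i +
    -- 1)`.
    have hC : 0 < 1 + |θ| + α := by positivity
    refine mt (summable_nat_add_iff 1).1 Real.not_summable_one_div_natCast ?_
    refine Summable.of_nonneg_of_le (fun i => by positivity) (fun i => ?_)
      (hs.mul_left ((1 + |θ| + α) / (1 - α)))
    have hp := add_pos ha (hb i)
    rw [hu, div_mul_div_cancel₀ ha.ne', div_le_div_iff₀ (by positivity) hp, Nat.cast_add_one]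
    have hi : (0 : ℝ) ≤ i := Nat.cast_nonneg i
    nlinarith [le_abs_self θ, abs_nonneg θ, mul_nonneg hi (abs_nonneg θ)]
  have key : ∀ i : ℕ, ∫⁻ x, ENNReal.ofReal (1 - x)
      ∂betaMeasure (1 - α) (θ + ((i : ℝ) + 1) * α) = ENNReal.ofReal (1 - u i) := fun i => by
    rw [lintegral_ofReal_one_sub_betaMeasure ha (hb i), hu]
    congr 1
    rw [eq_sub_iff_add_eq, ← add_div, add_comm, div_self (add_pos ha (hb i)).ne']
  simp_rw [key, ← ENNReal.ofReal_prod_of_nonneg fun i _ => sub_nonneg.2 (hu1 i)]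
  simpa [Function.comp_def] using (ENNReal.continuous_ofReal.tendsto 0).comp
    (tendsto_prod_one_sub_of_not_summable hu0 hu1 hu')

theorem ae_hazardLaw_summable_sq (h0 : 0 < α) (h1 : α < 1) (hθ : -α < θ) :
    ∀ᵐ h ∂hazardLaw α θ, Summable fun i => h i ^ 2 := by
  have ha : 0 < 1 - α := sub_pos.2 h1
  have hb := betaParam_pos h0.le hθ
  have (i : ℕ) : IsProbabilityMeasure (betaMeasure (1 - α) (θ + ((i : ℝ) + 1) * α)) :=
    isProbabilityMeasureBeta ha (hb i)
  refine ae_summable_sq (fun i => ae_betaMeasure_mem_Ioo _ _) ?_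
  simp_rw [lintegral_ofReal_sq_betaMeasure ha (hb _)]
  refine (Summable.tsum_ofReal_lt_top ?_).ne
  -- Writing the second beta parameter as `(θ + α) + i α` bounds it below by `c (i + 1)`; the
  -- numerators `1 - α` and `2 - α` are at most `1` and `2`.
  set c := min (θ + α) α with hc
  have hc0 : 0 < c := lt_min (by linarith) h0
  have hs : Summable fun i : ℕ => 2 / c ^ 2 * (1 / ((i + 1 : ℕ) : ℝ) ^ 2) :=
    ((summable_nat_add_iff 1).2 (Real.summable_one_div_nat_pow.2 one_lt_two)).mul_left _
  refine Summable.of_nonneg_of_le (fun i => ?_) (fun i => ?_) hs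
  · have := hb i
    positivity
  · have hci : c * ((i : ℝ) + 1) ≤ θ + ((i : ℝ) + 1) * α := by
      have hi : (0 : ℝ) ≤ i := Nat.cast_nonneg i
      nlinarith [min_le_left (θ + α) α, mul_le_mul_of_nonneg_left (min_le_right (θ + α) α) hi]
    have hci0 : 0 < c * ((i : ℝ) + 1) := by positivity
    have e : 2 / c ^ 2 * (1 / ((i + 1 : ℕ) : ℝ) ^ 2)
        = 1 / (c * ((i : ℝ) + 1)) * (2 / (c * ((i : ℝ) + 1))) := by
      push_cast
      field_simp
    rw [e]
    have hi := hb i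
    gcongr <;> linarith

theorem ae_hazardLaw_not_summable_pow (hθ : 0 < θ) :
    ∀ᵐ h ∂hazardLaw 0 θ, ∀ m : ℕ, ¬ Summable fun i => h i ^ m := by
  have := isProbabilityMeasureBeta one_pos hθ
  simpa [hazardLaw] using ae_not_summable_pow (ae_betaMeasure_mem_Ioo 1 θ)

end HazardLaw

/-! ### From the conditional law to the mixture -/

theorem measurable_limsup_numMax :
    ∀ c : ℕ∞, MeasurableSet {x : ℕ → ℕ | limsup (fun n => (numMax x n : ℕ∞)) atTop = c} := by
  -- The statement involves no σ-algebra on `ℕ∞`, so the Borel one may be chosen locally.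
  let _ : MeasurableSpace ℕ∞ := borel ℕ∞
  have : BorelSpace ℕ∞ := ⟨rfl⟩
  intro c
  refine measurableSet_eq_fun (Measurable.limsup fun n => ?_) measurable_const
  have : Measurable fun x : ℕ → ℕ => ((recordState (0, 0) x n).2 : ℕ∞) :=
    measurable_from_top.comp (measurable_snd.comp (measurable_recordState (0, 0) n))
  simpa only [recordState_zero_eq] using this

theorem ae_exchangeableLaw {α θ : ℝ} {s : Set (ℕ → ℕ)} (hs : MeasurableSet s)
    (h : ∀ᵐ h ∂hazardLaw α θ, ∀ᵐ x ∂iidLaw (cutPoint h), x ∈ s) :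
    ∀ᵐ x ∂exchangeableLaw α θ, x ∈ s := by
  change exchangeableLaw α θ sᶜ = 0
  have hm : Measurable fun h => iidLaw (cutPoint h) := measurable_iidLaw.comp measurable_cutPoint
  rw [exchangeableLaw, Measure.bind_apply hs.compl hm.aemeasurable]
  exact lintegral_eq_zero_of_ae_eq_zero h

end GEM

theorem mainTheorem8 {Ω : Type*} [MeasurableSpace Ω] (P : Measure Ω) [IsProbabilityMeasure P]
    (α θ : ℝ) (hα0 : 0 ≤ α) (hα1 : α < 1) (hθ : -α < θ)
    (X : ℕ → Ω → ℕ) (hX : HasLaw (fun ω n => X n ω) (GEM.exchangeableLaw α θ) P) :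
    (0 < α → ∀ᵐ ω ∂P,
      limsup (fun n : ℕ => (GEM.numMax (fun j => X j ω) n : ℕ∞)) atTop = 1) ∧
    (α = 0 → ∀ᵐ ω ∂P,
      limsup (fun n : ℕ => (GEM.numMax (fun j => X j ω) n : ℕ∞)) atTop = ⊤) := by
  have transfer : ∀ c : ℕ∞, (∀ᵐ h ∂GEM.hazardLaw α θ, ∀ᵐ x ∂GEM.iidLaw (GEM.cutPoint h),
      limsup (fun n : ℕ => (GEM.numMax x n : ℕ∞)) atTop = c) →
      ∀ᵐ ω ∂P, limsup (fun n : ℕ => (GEM.numMax (fun j => X j ω) n : ℕ∞)) atTop = c :=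
    fun c hc => (hX.ae_iff (measurableSet_setOfPred.1 (GEM.measurable_limsup_numMax c))).2
      (GEM.ae_exchangeableLaw (GEM.measurable_limsup_numMax c) hc)
  refine ⟨fun hα => transfer 1 ?_, fun hα => transfer ⊤ ?_⟩
  · filter_upwards [GEM.ae_hazardLaw_mem_Ioo hα0 hα1 hθ, GEM.ae_hazardLaw_tendsto_prod hα hα1 hθ,
      GEM.ae_hazardLaw_summable_sq hα hα1 hθ] with h hh hp hs
    exact GEM.ae_limsup_numMax_eq_one (GEM.valueLaw_cutPoint_real_Ici_ne_zero hh hp)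
      ((GEM.summable_hazard_valueLaw_pow hh hp 2).2 hs)
  · have hmem := GEM.ae_hazardLaw_mem_Ioo hα0 hα1 hθ
    subst hα
    filter_upwards [hmem, GEM.ae_hazardLaw_not_summable_pow (by linarith)] with h hh hs
    -- For `α = 0`, divergence of the first powers gives this pathwise, without expectations.
    have hp := GEM.tendsto_prod_one_sub_of_not_summable (fun i => (hh i).1.le)
      (fun i => (hh i).2.le) (by simpa using hs 1)
    exact GEM.ae_limsup_numMax_eq_top (GEM.valueLaw_cutPoint_real_Ici_ne_zero hh hp)
      fun m => mt (GEM.summable_hazard_valueLaw_pow hh hp m).1 (hs m)
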